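/- **Model.** There are $N$ agents on a connected non-bipartite graph $\mathcal G$ and $K\ge 2$ Bernoulli arms $a_1,\dots,a_K$ with success probabilities $p_1>p_2\ge\cdots\ge p_K\ge 0$. After each round every agent adopts one of the arms or the null arm $a_0$ (no preference); $X_i(r)$ is the adoption of agent $i$ after round $r$, and $\mathcal X(r)=(X_1(r),\dots,X_N(r))$; the initial profile $\mathcal X(0)$ is arbitrary. Round $r\ge 1$ runs as follows. * *Corruption.* A set of at most $\tau N$ agents, uniformly random among the sets of its size, is corrupted for this round. Each corrupted agent recommends an independent, uniformly random arm in place of its adoption. Every other agent with a non-null adoption recommends that adoption. * *Disseminating.* Every recommending agent issues $\lceil h\log N\rceil$ tokens carrying its recommendation ($h>0$). Each token performs an independent $L$-step Metropolis–Hastings random walk on $\mathcal G$: it moves from $i$ to a neighbour $j$ with probability $\Psi(i,j)=\min\{1/d_i,1/d_j\}$, where $d_i$ is the degree of $i$, and stays at $i$ with the remaining probability. The number $L$ is such that the walks are nearly uniform: $|\Psi^L(i,j)-\frac1N|\le\frac1{N^3}$ for all $i,j$. * *Sampling.* Each agent, corrupted or not, picks uniformly at random one of the tokens that ended at it and chooses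 the arm on it; it chooses no arm if it received none. An agent with a null adoption instead chooses a uniformly random arm with probability $\mu\in[0,1]$, and does the above with probability $1-\mu$. * *Adopting.* Each agent pulls the arm it chose, if any, and adopts it if the pull yields a reward (for arm $a_k$, with probability $p_k$); otherwise it keeps its adoption. Let $Q_1(r)$ be the fraction of the agents that adopt $a_1$ after round $r$, let $Z_1^+(r)$ be the number of agents that switch to $a_1$ in round $r$, and let $Z_1^-(r)$ be the number of agents that switch from $a_1$ to another arm in round $r$. **Theorem.** Let $0<\alpha<1$. There is an $N_0$ depending only on $K$, $p_1,\dots,p_K$ and $\alpha$ such that for all $N\ge N_0$ and every connected non-bipartite graph $\mathcal G$ on $N$ agents: 1. all sufficiently large $L$ (depending on $\mathcal G$) make the walks nearly uniform; 2. for every $L$ that makes the walks nearly uniform, all $h>0$ and $\mu\in[0,1]$, and all $$\tau\le\frac{(1-\alpha)(p_1-p_2)}{(1-\alpha)p_1+\alpha p_2},$$ the following holds in every round $r\ge 1$. For every profile $\mathcal X(r-1)$ of positive probability in which all agents have non-null adoptions and $Q_1(r-1)\le\alpha$, $$\mathbb E[Z_1^+(r)\mid\mathcal X(r-1)]\ \ge\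 \mathbb E[Z_1^-(r)\mid\mathcal X(r-1)].$$ -/

import Mathlib

open scoped unitInterval ENNReal

noncomputable section

namespace CollabBandit

/-! ### Elementary random choices -/

/-- A biased coin: `true` with probability `q`. -/
def coin (q : I) : PMF Bool :=
  PMF.ofFintype (fun b => ENNReal.ofReal (if b then (q : ℝ) else 1 - (q : ℝ))) (by
    have h0 : (0 : ℝ) ≤ q := q.2.1
    have h1 : (0 : ℝ) ≤ 1 - q := sub_nonneg.2 q.2.2
    rw [Fintype.sum_bool]
    simp only [if_true, Bool.false_eq_true, if_false]
    rw [← ENNReal.ofReal_add h0 h1]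
    simp)

/-- Independent random choices: the product of finitely many probability mass functions. -/
def indep {ι β : Type*} [Fintype ι] [Fintype β] (q : ι → PMF β) : PMF (ι → β) := by
  classical
  exact PMF.ofFintype (fun f => ∏ i, q i (f i)) (by
    have h := Finset.prod_univ_sum (fun _ : ι => (Finset.univ : Finset β)) (fun i b => q i b)
    rw [Fintype.piFinset_univ] at h
    rw [← h]
    refine Finset.prod_eq_one fun i _ => ?_
    have ht := (q i).tsum_coe
    rwa [tsum_fintype] at ht)

/-! ### Metropolis-Hastings random walks on the communication graph -/

section Walk

variable {N : ℕ} (G : SimpleGraph (Fin N)) [DecidableRel G.Adj]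

/-- Probability of forwarding a token from `i` to a neighbour `j`. -/
def edgeProb (i j : Fin N) : ℝ := min (1 / (G.degree i : ℝ)) (1 / (G.degree j : ℝ))

/-- The Metropolis-Hastings forwarding probabilities `Ψ(i, j)`. -/
def Psi (i j : Fin N) : ℝ :=
  if j = i then 1 - ∑ l ∈ G.neighborFinset i, edgeProb G i l
  else if G.Adj i j then edgeProb G i j else 0

lemma sum_edgeProb_le_one (i : Fin N) : ∑ l ∈ G.neighborFinset i, edgeProb G i l ≤ 1 := by
  calc ∑ l ∈ G.neighborFinset i, edgeProb G i l
      ≤ ∑ _l ∈ G.neighborFinset i, 1 / (G.degree i : ℝ) :=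
        Finset.sum_le_sum fun _ _ => min_le_left _ _
    _ = (G.degree i : ℝ) * (1 / (G.degree i : ℝ)) := by
        rw [Finset.sum_const, SimpleGraph.card_neighborFinset_eq_degree, nsmul_eq_mul]
    _ ≤ 1 := by
        rw [mul_one_div]
        exact div_self_le_one _

lemma Psi_nonneg (i j : Fin N) : 0 ≤ Psi G i j := by
  unfold Psi
  split_ifs
  · exact sub_nonneg.2 (sum_edgeProb_le_one G i)
  · unfold edgeProb
    positivity
  · exact le_rfl

lemma sum_Psi (i : Fin N) : ∑ j, Psi G i j = 1 := by
  have h : ∑ j ∈ Finset.univ.erase i, Psi G i j = ∑ l ∈ G.neighborFinset i, edgeProb G i l := by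
    have hsub : G.neighborFinset i ⊆ Finset.univ.erase i := by
      intro l hl
      rw [SimpleGraph.mem_neighborFinset] at hl
      exact Finset.mem_erase.2 ⟨hl.ne', Finset.mem_univ _⟩
    rw [← Finset.sum_subset hsub]
    · refine Finset.sum_congr rfl fun l hl => ?_
      rw [SimpleGraph.mem_neighborFinset] at hl
      simp [Psi, hl.ne', hl]
    · intro l hl hl'
      rw [SimpleGraph.mem_neighborFinset] at hl'
      simp [Psi, Finset.ne_of_mem_erase hl, hl']
  rw [← Finset.add_sum_erase _ _ (Finset.mem_univ i), h]
  simp [Psi]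

/-- One forwarding step of a token currently held by agent `i`. -/
def step (i : Fin N) : PMF (Fin N) :=
  PMF.ofFintype (fun j => ENNReal.ofReal (Psi G i j)) (by
    rw [← ENNReal.ofReal_sum_of_nonneg fun j _ => Psi_nonneg G i j, sum_Psi]
    simp)

/-- Final holder of a token that starts at agent `i` and is forwarded `L` times. -/
def walk : ℕ → Fin N → PMF (Fin N)
  | 0, i => PMF.pure i
  | L + 1, i => (step G i).bind (walk L)

/-- After `L` steps every walk has reached every agent with probability in
`[1/N - 1/N³, 1/N + 1/N³]`. -/
def NearlyUniform (L : ℕ) : Prop :=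
  ∀ i j : Fin N, |(walk G L i j).toReal - 1 / (N : ℝ)| ≤ 1 / (N : ℝ) ^ 3

end Walk

/-! ### One round of the collaborative learning algorithm -/

/-- An adoption: `none` is the null arm, `some 0` is the best arm. -/
abbrev Adoption (K : ℕ) := Option (Fin K)

/-- The adoptions of all `N` agents. -/
abbrev Profile (N K : ℕ) := Fin N → Adoption K

section Round

variable {N K : ℕ} [NeZero K]

/-- The recommendations that the agents really disseminate, when the agents in `C` are corrupted
and `f` holds the falsified arms. -/
def recommended (x : Profile N K) (C : Finset (Fin N)) (f : Fin N → Fin K) : Profile N K :=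
  fun j => if j ∈ C then some (f j) else x j

/-- Token `(j, t)` is the `t`-th token issued by agent `j` (it exists if `y j` is not null) and
`dest` gives the final holders. This is the set of the tokens received by agent `i`. -/
def received {T : ℕ} (y : Profile N K) (dest : Fin N × Fin T → Fin N) (i : Fin N) :
    Finset (Fin N × Fin T) :=
  Finset.univ.filter fun t => dest t = i ∧ (y t.1).isSome

/-- Agent `i` memorizes one of the received tokens uniformly at random, if there is one. -/
def suggestion {T : ℕ} (y : Profile N K) (dest : Fin N × Fin T → Fin N) (i : Fin N) :
    PMF (Adoption K) := by
  classical
  exact if h : (received y dest i).Nonempty then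
      (PMF.uniformOfFinset (received y dest i) h).map fun t => y t.1
    else PMF.pure none

/-- Sampling stage: an agent with a null adoption explores uniformly with probability `μ`, and in
all other cases follows its suggestion. -/
def choice (μ : I) (cur : Adoption K) (sug : PMF (Adoption K)) : PMF (Adoption K) :=
  match cur with
  | none => (coin μ).bind fun b =>
      if b then (PMF.uniformOfFintype (Fin K)).map some else sug
  | some _ => sug

/-- Adopting stage: the chosen arm is pulled, and it is adopted if it yields a reward. -/
def adopt (p : Fin K → I) (cur : Adoption K) : Adoption K → PMF (Adoption K)
  | none => PMF.pure cur
  | some k => (coin (p k)).map fun b => if b then some k else cur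

/-- The law of the adoptions after one round that starts with the adoptions `x`: `m` agents picked
uniformly at random are corrupted, each recommending an independent uniformly random arm; each
recommending agent issues `T` tokens that perform independent `L`-step walks; then all agents
(the corrupted ones included) sample and adopt. -/
def roundLaw (G : SimpleGraph (Fin N)) [DecidableRel G.Adj] (T L : ℕ) (μ : I) (p : Fin K → I)
    (m : Fin (N + 1)) (x : Profile N K) : PMF (Profile N K) :=
  (PMF.uniformOfFinset ((Finset.univ : Finset (Fin N)).powersetCard m)
    (Finset.powersetCard_nonempty.2 (by
      rw [Finset.card_univ, Fintype.card_fin]; exact Nat.lt_succ_iff.1 m.2))).bind fun C =>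
  (PMF.uniformOfFintype (Fin N → Fin K)).bind fun f =>
  (indep fun t : Fin N × Fin T => walk G L t.1).bind fun dest =>
  indep fun i => (choice μ (x i) (suggestion (recommended x C f) dest i)).bind (adopt p (x i))

/-- Number of tokens issued by each recommending agent: `h log N`, rounded up. -/
def tokenCount (h : ℝ) (N : ℕ) : ℕ := ⌈h * Real.log N⌉₊

/-- `Z₁`: the number of agents that adopt the best arm. -/
def bestCount (x : Profile N K) : ℕ := (Finset.univ.filter fun i => x i = some 0).card

/-- `Q₁`: the popularity of the best arm. -/
def popularity (x : Profile N K) : ℝ := (bestCount x : ℝ) / N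

/-- `Z₁⁺`: the number of agents that switch to the best arm between `x` and `y`. -/
def gained (x y : Profile N K) : ℕ :=
  (Finset.univ.filter fun i => x i ≠ some 0 ∧ y i = some 0).card

/-- `Z₁⁻`: the number of agents that switch from the best arm to another arm. -/
def lost (x y : Profile N K) : ℕ :=
  (Finset.univ.filter fun i => x i = some 0 ∧ ∃ k, k ≠ 0 ∧ y i = some k).card

/-- `X r` is the adoption profile after round `r` in a run of the algorithm in which `c r` agents
are corrupted in round `r`; the initial profile `X 0` is arbitrary. -/
structure IsRun (G : SimpleGraph (Fin N)) [DecidableRel G.Adj] (T L : ℕ) (μ : I) (p : Fin K → I)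
    (c : ℕ → Fin (N + 1)) {Ω : Type*} [MeasurableSpace Ω] (P : MeasureTheory.Measure Ω)
    (X : ℕ → Ω → Profile N K) : Prop where
  measurableSet_eq : ∀ r x, MeasurableSet {ω | X r ω = x}
  markov : ∀ (r : ℕ) (x : ℕ → Profile N K),
    P {ω | ∀ s ≤ r + 1, X s ω = x s} =
      P {ω | ∀ s ≤ r, X s ω = x s} * roundLaw G T L μ p (c (r + 1)) (x r) (x (r + 1))

end Round

end CollabBandit

end

/-! By the Markov property the two conditional expectations are expectations under `roundLaw`
started at `x`. Let `Q` be the popularity of the best arm, `s` the corrupted fraction and `S = s/K +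
(1-s)Q` the expected fraction of recommendations of the best arm. If walks were exactly uniform, all
tokens would be equally likely to be sampled, and up to one common factor the gain would be
`p₁(1-Q)S` and the loss at most `p₂Q(1-S)`.

With `D`, `E` the numerator and denominator of the bound on `τ`, gain minus loss bound is `Q(D - sE
+ (1-s)(α-Q)(p₁-p₂)) + (s/K)(p₁(1-Q) + p₂Q)`. The bound on `τ` gives `D - sE ≥ 0`. When this nearly
vanishes, `s` is bounded away from zero and the last term, from corrupted agents that recommend the
best arm by chance, supplies the slack. So the slack is at least `Qε` with `ε` depending only on
`K`, `p`, `α` (`loss_rate_le_gain_rate`).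

Near-uniformity costs only a factor `1 + 8/N` (`expect_sampleWeight_bounds`,
`expect_suggestion_bounds`), which the slack absorbs for large `N`. The common factor, which
includes the chance of receiving no token, cancels; hence neither the token count nor the graph
affects `N₀`. Mixing for large `L` is Doeblin contraction of a symmetric kernel that has a strictly
positive power. -/

noncomputable section

namespace CollabBandit


/-! ### Expectations over finite types -/

section Expect

variable {β γ ι : Type*} [Fintype β] [Fintype γ]

/-- The expectation of `F` under a probability mass function on a finite type. -/
def expect (q : PMF β) (F : β → ℝ) : ℝ := ∑ b, (q b).toReal * F b

lemma sum_toReal (q : PMF β) : ∑ b, (q b).toReal = 1 := by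
  rw [← ENNReal.toReal_sum fun b _ => q.apply_ne_top b, ← tsum_fintype (L := .unconditional β),
    q.tsum_coe, ENNReal.toReal_one]

lemma expect_const (q : PMF β) (a : ℝ) : expect q (fun _ => a) = a := by
  rw [expect, ← Finset.sum_mul, sum_toReal, one_mul]

lemma expect_mono (q : PMF β) {F F' : β → ℝ} (h : ∀ b, F b ≤ F' b) :
    expect q F ≤ expect q F' :=
  Finset.sum_le_sum fun b _ => mul_le_mul_of_nonneg_left (h b) ENNReal.toReal_nonneg

lemma expect_mul_left (q : PMF β) (a : ℝ) (F : β → ℝ) :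
    expect q (fun b => a * F b) = a * expect q F := by
  simp only [expect, Finset.mul_sum]
  exact Finset.sum_congr rfl fun b _ => by ring

lemma expect_add (q : PMF β) (F F' : β → ℝ) :
    expect q (fun b => F b + F' b) = expect q F + expect q F' := by
  simp only [expect, mul_add, Finset.sum_add_distrib]

lemma expect_sub (q : PMF β) (F F' : β → ℝ) :
    expect q (fun b => F b - F' b) = expect q F - expect q F' := by
  simp only [expect, mul_sub, Finset.sum_sub_distrib]

lemma expect_sum (q : PMF β) (s : Finset ι) (F : ι → β → ℝ) :
    expect q (fun b => ∑ i ∈ s, F i b) = ∑ i ∈ s, expect q (F i) := by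
  simp only [expect, Finset.mul_sum]
  exact Finset.sum_comm

lemma expect_pure (b : β) (F : β → ℝ) : expect (PMF.pure b) F = F b := by
  classical
  rw [expect, Finset.sum_eq_single b]
  · simp
  · intro c _ hc
    simp [PMF.pure_apply, hc]
  · simp

lemma expect_bind (q : PMF β) (f : β → PMF γ) (F : γ → ℝ) :
    expect (q.bind f) F = expect q fun b => expect (f b) F := by
  have h : ∀ c, ((q.bind f) c).toReal = ∑ b, (q b).toReal * (f b c).toReal := by
    intro c
    rw [PMF.bind_apply, tsum_fintype, ENNReal.toReal_sum]
    · simp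
    · exact fun b _ => ENNReal.mul_ne_top (q.apply_ne_top b) ((f b).apply_ne_top c)
  simp only [expect, h, Finset.sum_mul, Finset.mul_sum]
  rw [Finset.sum_comm]
  exact Finset.sum_congr rfl fun b _ => Finset.sum_congr rfl fun c _ => by ring

lemma expect_map (q : PMF β) (f : β → γ) (F : γ → ℝ) :
    expect (q.map f) F = expect q fun b => F (f b) := by
  rw [← PMF.bind_pure_comp, expect_bind]
  simp only [Function.comp_apply, expect_pure]

lemma expect_coin (q : I) (F : Bool → ℝ) :
    expect (coin q) F = q * F true + (1 - q) * F false := by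
  have h0 : (0 : ℝ) ≤ q := q.2.1
  have h1 : (0 : ℝ) ≤ 1 - q := sub_nonneg.2 q.2.2
  rw [expect, Fintype.sum_bool]
  simp [coin, PMF.ofFintype_apply, ENNReal.toReal_ofReal, h0, h1]

lemma expect_uniformOfFinset (s : Finset β) (hs : s.Nonempty) (F : β → ℝ) :
    expect (PMF.uniformOfFinset s hs) F = (∑ b ∈ s, F b) / s.card := by
  classical
  simp only [expect, PMF.uniformOfFinset_apply]
  rw [Finset.sum_div, ← Finset.sum_subset (Finset.subset_univ s)]
  · exact Finset.sum_congr rfl fun b hb => by simp [hb]; ring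
  · intro b _ hb
    simp [hb]

lemma expect_uniformOfFintype [Nonempty β] (F : β → ℝ) :
    expect (PMF.uniformOfFintype β) F = (∑ b, F b) / Fintype.card β := by
  rw [PMF.uniformOfFintype, expect_uniformOfFinset, Finset.card_univ]

lemma expect_indep_prod [Fintype ι] [DecidableEq ι] (q : ι → PMF β) (F : ι → β → ℝ) :
    expect (indep q) (fun f => ∏ i, F i (f i)) = ∏ i, expect (q i) (F i) := by
  classical
  simp only [expect]
  have h := Finset.prod_univ_sum (fun _ : ι => (Finset.univ : Finset β))
    (fun i b => (q i b).toReal * F i b)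
  rw [Fintype.piFinset_univ] at h
  rw [h]
  refine Finset.sum_congr rfl fun f _ => ?_
  rw [Finset.prod_mul_distrib, ← ENNReal.toReal_prod]
  rfl

lemma expect_indep_apply [Fintype ι] [DecidableEq ι] (q : ι → PMF β) (i : ι) (F : β → ℝ) :
    expect (indep q) (fun f => F (f i)) = expect (q i) F := by
  classical
  have h := expect_indep_prod q (fun j b => if j = i then F b else 1)
  rw [Finset.prod_eq_single i] at h
  · simp only [if_true] at h
    rw [← h]
    congr 1
    funext f
    rw [Finset.prod_eq_single i] <;> simp +contextual
  · intro j _ hj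
    simp [hj, expect_const]
  · simp

end Expect

/-! ### The conditional law of the next profile in a run -/

section Run

variable {N K : ℕ} [NeZero K] {G : SimpleGraph (Fin N)} [DecidableRel G.Adj] {T L : ℕ} {μ : I}
  {p : Fin K → I} {c : ℕ → Fin (N + 1)} {Ω : Type*} [MeasurableSpace Ω]
  {P : MeasureTheory.Measure Ω} {X : ℕ → Ω → Profile N K}

lemma IsRun.measurableSet_history (hX : IsRun G T L μ p c P X) (r : ℕ) (x : ℕ → Profile N K) :
    MeasurableSet {ω | ∀ s ≤ r, X s ω = x s} := by
  have : {ω | ∀ s ≤ r, X s ω = x s} = ⋂ s, ⋂ (_ : s ≤ r), {ω | X s ω = x s} := by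
    ext ω
    simp
  rw [this]
  exact MeasurableSet.iInter fun s => MeasurableSet.iInter fun _ => hX.measurableSet_eq s _

/-- `IsRun` speaks of full histories only; the one-step statement follows by summing over the
finitely many pasts before time `r`. -/
lemma IsRun.measure_inter (hX : IsRun G T L μ p c P X) (r : ℕ) (x y : Profile N K) :
    P ({ω | X r ω = x} ∩ {ω | X (r + 1) ω = y}) =
      P {ω | X r ω = x} * roundLaw G T L μ p (c (r + 1)) x y := by
  classical
  -- `e g` is the history with past `g`, then `x` at time `r` and `y` at time `r + 1`.
  obtain ⟨e, er, er1, el⟩ : ∃ e : (Fin r → Profile N K) → ℕ → Profile N K,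
      (∀ g, e g r = x) ∧ (∀ g, e g (r + 1) = y) ∧ ∀ g s (h : s < r), e g s = g ⟨s, h⟩ :=
    ⟨fun g s => if h : s < r then g ⟨s, h⟩ else if s = r then x else y, by simp, by simp,
      fun g s h => by simp [h]⟩
  have hdisj : ∀ n, r ≤ n → Pairwise (Function.onFun Disjoint
      fun g => {ω | ∀ s ≤ n, X s ω = e g s}) := by
    intro n hn g g' hgg'
    refine Set.disjoint_left.2 fun ω hω hω' => hgg' ?_
    funext s
    rw [← el g s s.2, ← el g' s s.2, ← hω s (s.2.le.trans hn), ← hω' s (s.2.le.trans hn)]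
  have h1 : {ω | X r ω = x} ∩ {ω | X (r + 1) ω = y} =
      ⋃ g : Fin r → Profile N K, {ω | ∀ s ≤ r + 1, X s ω = e g s} := by
    ext ω
    simp only [Set.mem_inter_iff, Set.mem_ofPred_eq, Set.mem_iUnion]
    constructor
    · rintro ⟨hx, hy⟩
      refine ⟨fun s : Fin r => X s.1 ω, fun s hs => ?_⟩
      rcases lt_trichotomy s r with h | rfl | h
      · exact (el (fun s : Fin r => X s.1 ω) s h).symm
      · exact hx.trans (er _).symm
      · obtain rfl : s = r + 1 := by omega
        exact hy.trans (er1 _).symm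
    · rintro ⟨g, hg⟩
      exact ⟨(hg r (by omega)).trans (er g), (hg (r + 1) le_rfl).trans (er1 g)⟩
  have h2 : {ω | X r ω = x} = ⋃ g : Fin r → Profile N K, {ω | ∀ s ≤ r, X s ω = e g s} := by
    ext ω
    simp only [Set.mem_ofPred_eq, Set.mem_iUnion]
    constructor
    · intro hx
      refine ⟨fun s : Fin r => X s.1 ω, fun s hs => ?_⟩
      rcases hs.lt_or_eq with h | rfl
      · exact (el (fun s : Fin r => X s.1 ω) s h).symm
      · exact hx.trans (er _).symm
    · rintro ⟨g, hg⟩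
      exact (hg r le_rfl).trans (er g)
  rw [h1, h2, MeasureTheory.measure_iUnion (hdisj _ (Nat.le_succ r))
      fun g => hX.measurableSet_history _ _,
    MeasureTheory.measure_iUnion (hdisj _ le_rfl) fun g => hX.measurableSet_history _ _,
    ← ENNReal.tsum_mul_right]
  refine tsum_congr fun g => ?_
  rw [hX.markov, er, er1]

lemma IsRun.integral_cond [MeasureTheory.IsProbabilityMeasure P] (hX : IsRun G T L μ p c P X)
    (r : ℕ) (x : Profile N K) (hx : P {ω | X r ω = x} ≠ 0)
    (F : Profile N K → Profile N K → ℝ) :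
    ∫ ω, F (X r ω) (X (r + 1) ω) ∂(ProbabilityTheory.cond P {ω | X r ω = x}) =
      expect (roundLaw G T L μ p (c (r + 1)) x) (F x) := by
  classical
  have hprob := ProbabilityTheory.cond_isProbabilityMeasure (μ := P) hx
  have hae : (fun ω => F (X r ω) (X (r + 1) ω))
      =ᵐ[ProbabilityTheory.cond P {ω | X r ω = x}]
      fun ω => ∑ y, Set.indicator {ω | X (r + 1) ω = y} (fun _ => F x y) ω := by
    filter_upwards [ProbabilityTheory.ae_cond_mem (hX.measurableSet_eq r x)] with ω hω
    have hω' : X r ω = x := hω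
    rw [Finset.sum_eq_single (X (r + 1) ω)]
    · simp [hω']
    · intro y _ hy
      simp [hy.symm]
    · simp
  rw [MeasureTheory.integral_congr_ae hae, MeasureTheory.integral_finsetSum]
  · refine Finset.sum_congr rfl fun y _ => ?_
    rw [MeasureTheory.integral_indicator_const _ (hX.measurableSet_eq _ _), smul_eq_mul,
      MeasureTheory.measureReal_def, ProbabilityTheory.cond_apply (hX.measurableSet_eq _ _),
      hX.measure_inter, ← mul_assoc, ENNReal.inv_mul_cancel hx (MeasureTheory.measure_ne_top _ _),
      one_mul]
  · intro y _
    exact (MeasureTheory.integrable_const _).indicator (hX.measurableSet_eq _ _)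

end Run


/-! ### Mixing of the Metropolis-Hastings walks -/

section GraphWalks

variable {V : Type*} {G : SimpleGraph V}

lemma exists_walk_length_add_two_mul {i j k : V} (w : G.Walk i j) (h : G.Adj i k) (n : ℕ) :
    ∃ w' : G.Walk i j, w'.length = w.length + 2 * n := by
  induction n with
  | zero => exact ⟨w, rfl⟩
  | succ n ih =>
    obtain ⟨w', hw'⟩ := ih
    refine ⟨.cons h (.cons h.symm w'), ?_⟩
    simp only [SimpleGraph.Walk.length_cons, hw']
    ring

/-- A non-bipartite graph has an odd closed walk at some `u`; a walk from `i` to `j` through `u`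
changes parity when this loop is inserted. -/
lemma exists_walk_length_mod_two (hG : G.Connected) (hb : ¬ G.IsBipartite) (i j : V)
    (n : ℕ) : ∃ w : G.Walk i j, w.length % 2 = n % 2 := by
  have h := mt SimpleGraph.two_colorable_iff_forall_loop_even.2 hb
  push Not at h
  obtain ⟨u, c, hc⟩ := h
  rw [Nat.not_even_iff] at hc
  obtain ⟨a⟩ := hG.preconnected i u
  obtain ⟨b⟩ := hG.preconnected u j
  by_cases hab : (a.append b).length % 2 = n % 2
  · exact ⟨_, hab⟩
  · refine ⟨a.append (c.append b), ?_⟩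
    simp only [SimpleGraph.Walk.length_append] at hab ⊢
    omega

end GraphWalks

section Mixing

variable {N : ℕ} (G : SimpleGraph (Fin N)) [DecidableRel G.Adj]

lemma Psi_symm (i j : Fin N) : Psi G i j = Psi G j i := by
  unfold Psi
  rcases eq_or_ne i j with rfl | h
  · rfl
  · simp only [h, h.symm, if_false, G.adj_comm i j, edgeProb, min_comm]

lemma Psi_pos {i j : Fin N} (h : G.Adj i j) : 0 < Psi G i j := by
  have hi : 0 < G.degree i := (G.degree_pos_iff_exists_adj i).2 ⟨j, h⟩
  have hj : 0 < G.degree j := (G.degree_pos_iff_exists_adj j).2 ⟨i, h.symm⟩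
  simp only [Psi, h.ne', h, if_false, if_true, edgeProb]
  positivity

/-- The `L`-step transition probabilities as real numbers. -/
def walkProb (L : ℕ) (i j : Fin N) : ℝ := (walk G L i j).toReal

lemma walkProb_nonneg (L : ℕ) (i j : Fin N) : 0 ≤ walkProb G L i j := ENNReal.toReal_nonneg

lemma sum_walkProb (L : ℕ) (i : Fin N) : ∑ j, walkProb G L i j = 1 := sum_toReal _

lemma walkProb_zero (i j : Fin N) : walkProb G 0 i j = if j = i then 1 else 0 := by
  simp only [walkProb, walk, PMF.pure_apply]
  split_ifs <;> simp

lemma walkProb_succ (L : ℕ) (i j : Fin N) :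
    walkProb G (L + 1) i j = ∑ l, Psi G i l * walkProb G L l j := by
  simp only [walkProb, walk]
  rw [PMF.bind_apply, tsum_fintype, ENNReal.toReal_sum]
  · refine Finset.sum_congr rfl fun l _ => ?_
    rw [ENNReal.toReal_mul, step, PMF.ofFintype_apply, ENNReal.toReal_ofReal (Psi_nonneg G i l)]
  · exact fun l _ => ENNReal.mul_ne_top (PMF.apply_ne_top _ _) (PMF.apply_ne_top _ _)

lemma walkProb_add (m n : ℕ) (i j : Fin N) :
    walkProb G (m + n) i j = ∑ l, walkProb G m i l * walkProb G n l j := by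
  induction m generalizing i with
  | zero => simp [walkProb_zero]
  | succ m ih =>
    rw [Nat.succ_add_eq_add_succ, Nat.add_succ, walkProb_succ]
    simp only [ih, walkProb_succ, Finset.mul_sum, Finset.sum_mul]
    rw [Finset.sum_comm]
    exact Finset.sum_congr rfl fun l _ => Finset.sum_congr rfl fun k _ => by ring

/-- Symmetry of `Psi` makes the kernel doubly stochastic, so the uniform law is stationary. -/
lemma sum_walkProb_left (L : ℕ) (j : Fin N) : ∑ i, walkProb G L i j = 1 := by
  induction L with
  | zero => simp [walkProb_zero]
  | succ L ih =>
    simp only [walkProb_succ]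
    rw [Finset.sum_comm]
    simp only [← Finset.sum_mul, Psi_symm G _, sum_Psi, one_mul]
    simpa only [Psi_symm G, sum_Psi, one_mul] using ih

lemma walkProb_length_pos {i j : Fin N} (w : G.Walk i j) : 0 < walkProb G w.length i j := by
  induction w with
  | nil => simp [walkProb_zero]
  | @cons u v w h q ih =>
    rw [SimpleGraph.Walk.length_cons, walkProb_succ]
    refine lt_of_lt_of_le (mul_pos (Psi_pos G h) ih) ?_
    exact Finset.single_le_sum (f := fun l => Psi G u l * walkProb G q.length l w)
      (fun l _ => mul_nonneg (Psi_nonneg G u l) (walkProb_nonneg G _ l w)) (Finset.mem_univ v)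

variable {G}

/-- Even walks join all pairs, and stepping back and forth along an edge pads them all to one common
even length. -/
lemma exists_forall_walkProb_pos (hG : G.Connected) (hb : ¬ G.IsBipartite) :
    ∃ n, ∀ i j, 0 < walkProb G n i j := by
  choose w hw using fun i j => exists_walk_length_mod_two hG hb i j 0
  refine ⟨2 * ∑ i, ∑ j, (w i j).length, fun i j => ?_⟩
  have hle : (w i j).length ≤ ∑ i, ∑ j, (w i j).length :=
    (Finset.single_le_sum (f := fun j => (w i j).length) (fun _ _ => Nat.zero_le _)
      (Finset.mem_univ j)).trans
      (Finset.single_le_sum (f := fun i => ∑ j, (w i j).length) (fun _ _ => Nat.zero_le _)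
        (Finset.mem_univ i))
  -- In a connected graph a vertex without neighbours is the only one, and a constant colouring
  -- would make the graph bipartite.
  have hadj : ∃ k, G.Adj i k := by
    by_contra! hno
    refine hb ⟨SimpleGraph.Coloring.mk (fun _ => 0) fun {u v} huv => ?_⟩
    obtain ⟨a⟩ := hG.preconnected i u
    cases a with
    | nil => exact absurd huv (hno _)
    | cons h _ => exact absurd h (hno _)
  obtain ⟨k, hk⟩ := hadj
  obtain ⟨w', hw'⟩ := exists_walk_length_add_two_mul (w i j) hk
    (∑ i, ∑ j, (w i j).length - (w i j).length / 2)
  have := walkProb_length_pos G w'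
  have hl := hw i j
  rwa [hw', show (w i j).length + 2 * (∑ i, ∑ j, (w i j).length - (w i j).length / 2) =
    2 * ∑ i, ∑ j, (w i j).length by omega] at this

/-- A kernel that gives weight at least `δ / N` to every state contracts the deviation from
uniformity. -/
lemma abs_walkProb_add_sub_le {n : ℕ} {δ B : ℝ} (hN : 0 < N)
    (hδ : ∀ i j, δ / N ≤ walkProb G n i j) {L : ℕ} {j : Fin N}
    (hB : ∀ l, |walkProb G L l j - 1 / N| ≤ B) (i : Fin N) :
    |walkProb G (n + L) i j - 1 / N| ≤ (1 - δ) * B := by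
  have hN' : (N : ℝ) ≠ 0 := by positivity
  have h0 : ∑ l, (walkProb G L l j - 1 / N) = 0 := by
    rw [Finset.sum_sub_distrib, sum_walkProb_left]
    simp [hN']
  -- The deviations from `1/N` sum to zero, so subtracting the constant `δ/N` from the kernel
  -- changes nothing; the remaining weights are nonnegative with total `1 - δ`.
  have h1 : walkProb G (n + L) i j - 1 / N =
      ∑ l, (walkProb G n i l - δ / N) * (walkProb G L l j - 1 / N) := by
    have h2 : ∑ l, (walkProb G n i l - δ / N) * (walkProb G L l j - 1 / N) =
        ∑ l, walkProb G n i l * (walkProb G L l j - 1 / N) -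
          δ / N * ∑ l, (walkProb G L l j - 1 / N) := by
      rw [Finset.mul_sum, ← Finset.sum_sub_distrib]
      exact Finset.sum_congr rfl fun l _ => by ring
    rw [h2, h0]
    simp only [mul_sub, Finset.sum_sub_distrib, ← Finset.sum_mul, sum_walkProb, walkProb_add]
    ring
  rw [h1]
  calc |∑ l, (walkProb G n i l - δ / N) * (walkProb G L l j - 1 / N)|
      ≤ ∑ l, |(walkProb G n i l - δ / N) * (walkProb G L l j - 1 / N)| :=
        Finset.abs_sum_le_sum_abs _ _
    _ ≤ ∑ l, (walkProb G n i l - δ / N) * B := by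
        refine Finset.sum_le_sum fun l _ => ?_
        have h := sub_nonneg.2 (hδ i l)
        rw [abs_mul, abs_of_nonneg h]
        exact mul_le_mul_of_nonneg_left (hB l) h
    _ = (1 - δ) * B := by
        rw [← Finset.sum_mul, Finset.sum_sub_distrib, sum_walkProb]
        simp [mul_div_cancel₀ _ hN']

lemma exists_forall_nearlyUniform (hG : G.Connected) (hb : ¬ G.IsBipartite) :
    ∃ L₀ : ℕ, ∀ L : ℕ, L₀ ≤ L → NearlyUniform G L := by
  have := hG.nonempty
  have hN : 0 < N := Fin.pos_iff_nonempty.2 hG.nonempty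
  have hN' : (0 : ℝ) < N := by exact_mod_cast hN
  obtain ⟨n, hn⟩ := exists_forall_walkProb_pos hG hb
  obtain ⟨z, hz⟩ := Finite.exists_min fun z : Fin N × Fin N => walkProb G n z.1 z.2
  set δ : ℝ := N * walkProb G n z.1 z.2 with hδdef
  have hδ0 : 0 < δ := mul_pos hN' (hn _ _)
  have hδ : ∀ i j, δ / N ≤ walkProb G n i j := fun i j => by
    rw [hδdef, mul_div_cancel_left₀ _ hN'.ne']
    exact hz (i, j)
  have hδ1 : δ ≤ 1 := by
    have h := Finset.sum_le_sum fun (j : Fin N) (_ : j ∈ Finset.univ) => hδ z.1 j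
    rw [sum_walkProb] at h
    simpa [mul_div_cancel₀ _ hN'.ne'] using h
  -- The free remainder `L` makes the estimate valid for every length from `n * q` on.
  have key : ∀ q L, ∀ i j, |walkProb G (n * q + L) i j - 1 / N| ≤ (1 - δ) ^ q := by
    intro q
    induction q with
    | zero =>
      intro L i j
      have h1 : walkProb G L i j ≤ 1 := by
        rw [← sum_walkProb G L i]
        exact Finset.single_le_sum (fun l _ => walkProb_nonneg G L i l) (Finset.mem_univ j)
      have h2 : 1 / (N : ℝ) ≤ 1 := by
        rw [div_le_one hN']
        exact_mod_cast hN
      have h3 := walkProb_nonneg G L i j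
      have h4 : 0 < 1 / (N : ℝ) := by positivity
      rw [Nat.mul_zero, Nat.zero_add, pow_zero, abs_le]
      constructor <;> linarith
    | succ q ih =>
      intro L i j
      rw [pow_succ', show n * (q + 1) + L = n + (n * q + L) by ring]
      exact abs_walkProb_add_sub_le hN hδ (fun l => ih L l j) i
  obtain ⟨q, hq⟩ := exists_pow_lt_of_lt_one (show (0 : ℝ) < 1 / (N : ℝ) ^ 3 by positivity)
    (show 1 - δ < 1 by linarith)
  refine ⟨n * q, fun L hL i j => ?_⟩
  have h := key q (L - n * q) i j
  rw [Nat.add_sub_cancel' hL] at h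
  exact h.trans hq.le

end Mixing


/-! ### The probability that a given token is sampled -/

section TokenWeight

variable {ι β : Type*} [Fintype ι] [DecidableEq ι] [DecidableEq β]

/-- The weight of token `t` in a uniform sample from the tokens that end at `i`. -/
def sampleWeight (d : ι → β) (i : β) (t : ι) : ℝ :=
  if d t = i then 1 / ((Finset.univ.filter fun t' => d t' = i).card : ℝ) else 0

/-- The factor of token `t'` in the integral representation of the weight of token `t`. -/
def weightFactor (i : β) (t : ι) (s : ℝ) (t' : ι) (v : β) : ℝ :=
  if t' = t then (if v = i then 1 else 0) else if v = i then s else 1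

lemma prod_weightFactor (d : ι → β) (i : β) (t : ι) (s : ℝ) :
    ∏ t', weightFactor i t s t' (d t') =
      if d t = i then s ^ ((Finset.univ.filter fun t' => d t' = i).card - 1) else 0 := by
  rw [← Finset.mul_prod_erase _ _ (Finset.mem_univ t)]
  by_cases h : d t = i
  · have h1 : ∏ t' ∈ Finset.univ.erase t, weightFactor i t s t' (d t') =
        ∏ t' ∈ Finset.univ.erase t, if d t' = i then s else 1 :=
      Finset.prod_congr rfl fun t' ht' => by simp [weightFactor, Finset.ne_of_mem_erase ht']
    have h2 : (Finset.univ.erase t).filter (fun t' => d t' = i) =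
        (Finset.univ.filter fun t' => d t' = i).erase t := by
      ext t'
      simp
    rw [h1, Finset.prod_ite, Finset.prod_const, Finset.prod_const_one, h2,
      Finset.card_erase_of_mem (by simp [h])]
    simp [weightFactor, h]
  · simp [weightFactor, h]

/-- Since `1/n = ∫₀¹ sⁿ⁻¹ ds`, the reciprocal of the random token count becomes an integral of a
product over tokens, whose expectation factorises by independence. -/
lemma sampleWeight_eq_integral (d : ι → β) (i : β) (t : ι) :
    sampleWeight d i t = ∫ s in (0 : ℝ)..1, ∏ t', weightFactor i t s t' (d t') := by
  simp only [prod_weightFactor, sampleWeight]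
  split_ifs with h
  · have hpos : 0 < (Finset.univ.filter fun t' => d t' = i).card :=
      Finset.card_pos.2 ⟨t, by simp [h]⟩
    obtain ⟨n, hn⟩ := Nat.exists_eq_succ_of_ne_zero hpos.ne'
    rw [hn]
    simp
  · simp

variable [Fintype β]

lemma expect_ite_eq (q : PMF β) (i : β) : expect q (fun v => if v = i then 1 else 0) =
    (q i).toReal := by
  simp [expect]

lemma expect_sampleWeight (q : ι → PMF β) (i : β) (t : ι) :
    expect (indep q) (fun d => sampleWeight d i t) =
      (q t i).toReal *
        ∫ s in (0 : ℝ)..1, ∏ t' ∈ Finset.univ.erase t, (1 - (q t' i).toReal * (1 - s)) := by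
  have hfac : ∀ s, ∏ t', expect (q t') (weightFactor i t s t') = (q t i).toReal *
      ∏ t' ∈ Finset.univ.erase t, (1 - (q t' i).toReal * (1 - s)) := by
    intro s
    rw [← Finset.mul_prod_erase _ _ (Finset.mem_univ t)]
    congr 1
    · rw [← expect_ite_eq]
      congr 1
      funext v
      simp [weightFactor]
    · refine Finset.prod_congr rfl fun t' ht' => ?_
      have h : weightFactor i t s t' = fun v => 1 - (1 - s) * if v = i then 1 else 0 := by
        funext v
        simp only [weightFactor, Finset.ne_of_mem_erase ht', if_false]
        split_ifs <;> ring
      rw [h, expect_sub, expect_const, expect_mul_left, expect_ite_eq]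
      ring
  rw [← intervalIntegral.integral_const_mul]
  simp only [← hfac, ← expect_indep_prod, sampleWeight_eq_integral]
  simp only [expect]
  rw [intervalIntegral.integral_finsetSum]
  · simp only [intervalIntegral.integral_const_mul]
  · intro d _
    refine Continuous.intervalIntegrable ?_ _ _
    refine continuous_const.mul (continuous_finsetProd _ fun t' _ => ?_)
    unfold weightFactor
    split_ifs <;> fun_prop

/-- Substituting `v = c(1-s)` gives `∫₀ᶜ (1-v)ⁿ dv`, whose integrand is nonnegative for `v ≤ 1`. -/
lemma mul_integral_one_sub_pow_mono {a b : ℝ} (ha : 0 ≤ a) (hab : a ≤ b) (hb : b ≤ 1) (n : ℕ) :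
    a * ∫ s in (0 : ℝ)..1, (1 - a * (1 - s)) ^ n ≤
      b * ∫ s in (0 : ℝ)..1, (1 - b * (1 - s)) ^ n := by
  have h : ∀ c : ℝ, c * ∫ s in (0 : ℝ)..1, (1 - c * (1 - s)) ^ n =
      ∫ v in (0 : ℝ)..c, (1 - v) ^ n := by
    intro c
    rw [intervalIntegral.integral_comp_sub_left (fun u => (1 - c * u) ^ n) 1,
      intervalIntegral.mul_integral_comp_mul_left (f := fun v => (1 - v) ^ n)]
    simp
  rw [h, h]
  refine intervalIntegral.integral_mono_interval le_rfl ha hab ?_ ?_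
  · filter_upwards [MeasureTheory.ae_restrict_mem measurableSet_Ioc] with v hv
    exact pow_nonneg (by linarith [hv.2]) n
  · exact Continuous.intervalIntegrable (by fun_prop) _ _

/-- If all tokens end at `i` with nearly the same probability, then they are all sampled with
nearly the same probability. -/
lemma expect_sampleWeight_bounds {a b : ℝ} (ha : 0 < a) (hb : b ≤ 1) (hab : a ≤ b) :
    ∃ w : ℝ, 0 ≤ w ∧ ∀ (q : ι → PMF β) (i : β),
      (∀ t, a ≤ (q t i).toReal ∧ (q t i).toReal ≤ b) → ∀ t,
      w ≤ expect (indep q) (fun d => sampleWeight d i t) ∧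
        expect (indep q) (fun d => sampleWeight d i t) ≤ (b / a) ^ 2 * w := by
  set n := Fintype.card ι - 1
  have hfac0 : ∀ c ≤ (1 : ℝ), 0 ≤ c → ∀ s ∈ Set.Icc (0 : ℝ) 1, 0 ≤ 1 - c * (1 - s) := by
    intro c hc hc0 s hs
    nlinarith [hs.1, hs.2]
  have hJ : ∀ c ≤ (1 : ℝ), 0 ≤ c → 0 ≤ ∫ s in (0 : ℝ)..1, (1 - c * (1 - s)) ^ n := fun c hc hc0 =>
    intervalIntegral.integral_nonneg zero_le_one fun s hs => pow_nonneg (hfac0 c hc hc0 s hs) n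
  have hJb := hJ b hb (ha.le.trans hab)
  -- The witness takes the least probability for `t` itself and the greatest for its competitors.
  -- Monotonicity of `c ∫ (1 - c(1-s))ⁿ` then bounds the opposite extreme by `(b/a)²` times it,
  -- whatever the number of tokens.
  refine ⟨a * ∫ s in (0 : ℝ)..1, (1 - b * (1 - s)) ^ n, mul_nonneg ha.le hJb, ?_⟩
  intro q i hq t
  have hcard : (Finset.univ.erase t).card = n := by
    rw [Finset.card_erase_of_mem (Finset.mem_univ t), Finset.card_univ]
  have hint : ∀ f : ι → ℝ, IntervalIntegrable
      (fun s => ∏ t' ∈ Finset.univ.erase t, (1 - f t' * (1 - s))) MeasureTheory.volume 0 1 :=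
    fun f => Continuous.intervalIntegrable (by fun_prop) _ _
  have hint' : ∀ c : ℝ, IntervalIntegrable
      (fun s => (1 - c * (1 - s)) ^ n) MeasureTheory.volume 0 1 :=
    fun c => Continuous.intervalIntegrable (by fun_prop) _ _
  have hlo : ∫ s in (0 : ℝ)..1, (1 - b * (1 - s)) ^ n ≤
      ∫ s in (0 : ℝ)..1, ∏ t' ∈ Finset.univ.erase t, (1 - (q t' i).toReal * (1 - s)) := by
    refine intervalIntegral.integral_mono_on zero_le_one (hint' b) (hint _) fun s hs => ?_
    rw [← hcard, ← Finset.prod_const]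
    refine Finset.prod_le_prod (fun _ _ => hfac0 b hb (ha.le.trans hab) s hs) fun t' _ => ?_
    nlinarith [(hq t').2, hs.2]
  have hhi : ∫ s in (0 : ℝ)..1, ∏ t' ∈ Finset.univ.erase t, (1 - (q t' i).toReal * (1 - s)) ≤
      ∫ s in (0 : ℝ)..1, (1 - a * (1 - s)) ^ n := by
    refine intervalIntegral.integral_mono_on zero_le_one (hint _) (hint' a) fun s hs => ?_
    rw [← hcard, ← Finset.prod_const]
    refine Finset.prod_le_prod
      (fun t' _ => hfac0 _ ((hq t').2.trans hb) (ha.le.trans (hq t').1) s hs) fun t' _ => ?_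
    nlinarith [(hq t').1, hs.2]
  rw [expect_sampleWeight]
  refine ⟨mul_le_mul (hq t).1 hlo hJb (ha.le.trans (hq t).1), ?_⟩
  calc (q t i).toReal * ∫ s in (0 : ℝ)..1,
        ∏ t' ∈ Finset.univ.erase t, (1 - (q t' i).toReal * (1 - s))
      ≤ b * ∫ s in (0 : ℝ)..1, (1 - a * (1 - s)) ^ n :=
        mul_le_mul (hq t).2 hhi (hJb.trans hlo) (ha.le.trans hab)
    _ = b / a * (a * ∫ s in (0 : ℝ)..1, (1 - a * (1 - s)) ^ n) := by
        field_simp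
    _ ≤ b / a * (b * ∫ s in (0 : ℝ)..1, (1 - b * (1 - s)) ^ n) :=
        mul_le_mul_of_nonneg_left (mul_integral_one_sub_pow_mono ha.le hab hb n)
          (div_nonneg (ha.le.trans hab) ha.le)
    _ = (b / a) ^ 2 * (a * ∫ s in (0 : ℝ)..1, (1 - b * (1 - s)) ^ n) := by
        field_simp

end TokenWeight


/-! ### Expected gains and losses in one round -/

section RoundBounds

variable {N K : ℕ}

/-- Without null recommendations every token exists, and `F none = 0` removes the event that none
arrives. -/
lemma expect_suggestion {T : ℕ} {y : Profile N K} (hy : ∀ j, y j ≠ none)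
    (dest : Fin N × Fin T → Fin N) (i : Fin N) (F : Adoption K → ℝ) (hF : F none = 0) :
    expect (suggestion y dest i) F = ∑ t, sampleWeight dest i t * F (y t.1) := by
  classical
  have hr : received y dest i = Finset.univ.filter fun t => dest t = i := by
    ext t
    simp [received, Option.isSome_iff_ne_none, hy]
  by_cases h : (received y dest i).Nonempty
  · rw [suggestion, dif_pos h, expect_map, expect_uniformOfFinset]
    simp only [hr, sampleWeight, ite_mul, zero_mul]
    rw [← Finset.sum_filter, Finset.sum_div]
    exact Finset.sum_congr rfl fun t _ => by ring
  · rw [suggestion, dif_neg h, expect_pure, hF]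
    rw [Finset.not_nonempty_iff_eq_empty, hr, Finset.filter_eq_empty_iff] at h
    symm
    exact Finset.sum_eq_zero fun t ht => by simp [sampleWeight, h ht]

lemma recommended_ne_none {x : Profile N K} (hx : ∀ i, x i ≠ none) (C : Finset (Fin N))
    (f : Fin N → Fin K) (j : Fin N) : recommended x C f j ≠ none := by
  unfold recommended
  split_ifs
  · simp
  · exact hx j

/-- If the walks are nearly uniform, then the suggestions nearly follow the fractions of the
recommendations. -/
lemma expect_suggestion_bounds (hN : 2 ≤ N) (T : ℕ) :
    ∃ w : ℝ, 0 ≤ w ∧ ∀ (G : SimpleGraph (Fin N)) [DecidableRel G.Adj] (L : ℕ),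
      NearlyUniform G L → ∀ (y : Profile N K), (∀ j, y j ≠ none) → ∀ (i : Fin N)
      (F : Adoption K → ℝ), F none = 0 → (∀ v, 0 ≤ F v) →
      w * ∑ j, F (y j) ≤ expect (indep fun t : Fin N × Fin T => walk G L t.1)
          (fun dest => expect (suggestion y dest i) F) ∧
        expect (indep fun t : Fin N × Fin T => walk G L t.1)
          (fun dest => expect (suggestion y dest i) F) ≤
          (1 + 8 / N) * w * ∑ j, F (y j) := by
  have hN' : (2 : ℝ) ≤ N := by exact_mod_cast hN
  have hN0 : (0 : ℝ) < N := by linarith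
  have hN3 : 1 / (N : ℝ) ^ 3 = 1 / N * (1 / (N : ℝ) ^ 2) := by field_simp
  have hN2 : 1 / (N : ℝ) ^ 2 < 1 := by
    rw [div_lt_one (by positivity)]
    nlinarith
  have ha : 0 < 1 / (N : ℝ) - 1 / (N : ℝ) ^ 3 := by
    rw [hN3]
    have : 0 < 1 / (N : ℝ) := by positivity
    nlinarith
  have hb : 1 / (N : ℝ) + 1 / (N : ℝ) ^ 3 ≤ 1 := by
    have h1 : 1 / (N : ℝ) ≤ 1 / 2 := one_div_le_one_div_of_le (by norm_num) hN'
    have : 0 < 1 / (N : ℝ) := by positivity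
    rw [hN3]
    nlinarith
  have hab : 1 / (N : ℝ) - 1 / (N : ℝ) ^ 3 ≤ 1 / (N : ℝ) + 1 / (N : ℝ) ^ 3 := by
    have : 0 < 1 / (N : ℝ) ^ 3 := by positivity
    linarith
  -- The ratio of the extreme probabilities is at most `1 + 2/N`, and `(1 + 2/N)² ≤ 1 + 8/N`.
  have hratio : ((1 / (N : ℝ) + 1 / (N : ℝ) ^ 3) / (1 / (N : ℝ) - 1 / (N : ℝ) ^ 3)) ^ 2 ≤
      1 + 8 / N := by
    have h1 : (1 / (N : ℝ) + 1 / (N : ℝ) ^ 3) / (1 / (N : ℝ) - 1 / (N : ℝ) ^ 3) ≤ 1 + 2 / N := by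
      rw [div_le_iff₀ ha]
      have h2 : (1 + 2 / (N : ℝ)) * (1 / N - 1 / (N : ℝ) ^ 3) - (1 / N + 1 / (N : ℝ) ^ 3) =
          2 * ((N : ℝ) ^ 2 - N - 1) / (N : ℝ) ^ 4 := by
        field_simp
        ring
      have h3 : 0 ≤ 2 * ((N : ℝ) ^ 2 - N - 1) / (N : ℝ) ^ 4 :=
        div_nonneg (by nlinarith) (by positivity)
      linarith
    have h0 := div_nonneg (ha.le.trans hab) ha.le
    have h4 : (1 : ℝ) + 8 / N - (1 + 2 / N) ^ 2 = 4 * (N - 1) / (N : ℝ) ^ 2 := by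
      field_simp
      ring
    have h5 : 0 ≤ 4 * ((N : ℝ) - 1) / (N : ℝ) ^ 2 := div_nonneg (by linarith) (by positivity)
    have h6 := pow_le_pow_left₀ h0 h1 2
    linarith
  obtain ⟨w, hw0, hw⟩ := expect_sampleWeight_bounds (ι := Fin N × Fin T) (β := Fin N) ha hb hab
  -- Each recommendation is carried by `T` tokens.
  refine ⟨T * w, by positivity, fun G _ L hL y hy i F hF hF0 => ?_⟩
  have hq : ∀ t : Fin N × Fin T, 1 / (N : ℝ) - 1 / (N : ℝ) ^ 3 ≤ (walk G L t.1 i).toReal ∧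
      (walk G L t.1 i).toReal ≤ 1 / (N : ℝ) + 1 / (N : ℝ) ^ 3 := fun t => by
    have h := abs_le.1 (hL t.1 i)
    constructor <;> linarith [h.1, h.2]
  have hw' := hw (fun t => walk G L t.1) i hq
  have heq : expect (indep fun t : Fin N × Fin T => walk G L t.1)
      (fun dest => expect (suggestion y dest i) F) =
      ∑ t : Fin N × Fin T, expect (indep fun t : Fin N × Fin T => walk G L t.1)
        (fun dest => sampleWeight dest i t) * F (y t.1) := by
    simp only [expect_suggestion hy _ i F hF, expect_sum]
    refine Finset.sum_congr rfl fun t _ => ?_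
    rw [mul_comm, ← expect_mul_left]
    exact congrArg _ (funext fun d => mul_comm _ _)
  have hsum : ∀ a : ℝ, ∑ t : Fin N × Fin T, a * F (y t.1) = T * a * ∑ j, F (y j) := by
    intro a
    rw [Fintype.sum_prod_type]
    simp only [Finset.sum_const, Finset.card_univ, Fintype.card_fin, nsmul_eq_mul,
      ← Finset.mul_sum]
    ring
  rw [heq]
  constructor
  · rw [← hsum]
    exact Finset.sum_le_sum fun t _ => mul_le_mul_of_nonneg_right (hw' t).1 (hF0 _)
  · rw [show (1 + 8 / (N : ℝ)) * (T * w) = T * ((1 + 8 / N) * w) by ring, ← hsum]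
    refine Finset.sum_le_sum fun t _ => mul_le_mul_of_nonneg_right ((hw' t).2.trans ?_) (hF0 _)
    exact mul_le_mul_of_nonneg_right hratio hw0

variable [NeZero K]

lemma choice_of_ne_none (μ : I) {cur : Adoption K} (h : cur ≠ none) (sug : PMF (Adoption K)) :
    choice μ cur sug = sug := by
  obtain ⟨k, rfl⟩ := Option.ne_none_iff_exists'.1 h
  rfl

/-- The indicator of the best arm. -/
def isBest (v : Adoption K) : ℝ := if v = some 0 then 1 else 0

/-- The indicator of the other arms. -/
def isOther (v : Adoption K) : ℝ := if ∃ k, k ≠ 0 ∧ v = some k then 1 else 0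

lemma isBest_nonneg (v : Adoption K) : 0 ≤ isBest v := by
  unfold isBest
  split_ifs <;> norm_num

lemma isOther_nonneg (v : Adoption K) : 0 ≤ isOther v := by
  unfold isOther
  split_ifs <;> norm_num

lemma isOther_some (k : Fin K) : isOther (some k) = 1 - isBest (some k) := by
  by_cases h : k = 0 <;> simp [isOther, isBest, h]

lemma isOther_eq {v : Adoption K} (hv : v ≠ none) : isOther v = 1 - isBest v := by
  obtain ⟨k, rfl⟩ := Option.ne_none_iff_exists'.1 hv
  exact isOther_some k

lemma expect_adopt_isBest (p : Fin K → I) {cur : Adoption K} (hcur : cur ≠ some 0)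
    (v : Adoption K) : expect (adopt p cur v) isBest = p 0 * isBest v := by
  rcases v with _ | k
  · simp [adopt, expect_pure, isBest, hcur]
  · by_cases hk : k = 0
    · subst hk
      simp [adopt, expect_map, expect_coin, isBest, hcur]
    · simp [adopt, expect_map, expect_coin, isBest, hcur, hk]

/-- An agent on the best arm leaves it only through a rewarded pull of another arm. -/
lemma expect_adopt_isOther_le (p : Fin K → I) {a : ℝ} (hp : ∀ k, k ≠ 0 → (p k : ℝ) ≤ a)
    (v : Adoption K) : expect (adopt p (some 0) v) isOther ≤ a * isOther v := by
  rcases v with _ | k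
  · simp [adopt, expect_pure, isOther]
  · by_cases hk : k = 0
    · subst hk
      simp [adopt, expect_map, expect_coin, isOther]
    · simpa [adopt, expect_map, expect_coin, isOther, hk] using hp k hk

/-- The law of the set of corrupted agents. -/
def corruptedLaw (m : Fin (N + 1)) : PMF (Finset (Fin N)) :=
  PMF.uniformOfFinset ((Finset.univ : Finset (Fin N)).powersetCard m)
    (Finset.powersetCard_nonempty.2 (by
      rw [Finset.card_univ, Fintype.card_fin]; exact Nat.lt_succ_iff.1 m.2))

/-- The sets that avoid `j` are the `m`-subsets of the other agents, a fraction `1 - m/N` of all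
`m`-subsets. -/
lemma expect_corruptedLaw_notMem (m : Fin (N + 1)) (j : Fin N) :
    expect (corruptedLaw m) (fun C => if j ∈ C then 0 else 1) = 1 - (m : ℝ) / N := by
  have hm : (m : ℕ) ≤ N := Nat.lt_succ_iff.1 m.2
  obtain ⟨n, rfl⟩ : ∃ n, N = n + 1 := ⟨N - 1, by have := j.pos; omega⟩
  have hfil : (((Finset.univ : Finset (Fin (n + 1))).powersetCard m).filter fun C => j ∉ C) =
      (Finset.univ.erase j).powersetCard m := by
    ext C
    simp only [Finset.mem_filter, Finset.mem_powersetCard, Finset.subset_univ, true_and,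
      Finset.subset_erase]
    tauto
  have hsum : ∑ C ∈ (Finset.univ : Finset (Fin (n + 1))).powersetCard m,
      (if j ∈ C then (0 : ℝ) else 1) = n.choose m := by
    have h : ∀ C : Finset (Fin (n + 1)), (if j ∈ C then (0 : ℝ) else 1) = if j ∉ C then 1 else 0 :=
      fun C => by split_ifs <;> simp_all
    simp only [h]
    rw [Finset.sum_boole, hfil, Finset.card_powersetCard, Finset.card_erase_of_mem
      (Finset.mem_univ j), Finset.card_univ, Fintype.card_fin, Nat.add_sub_cancel]
  have hpos : (0 : ℝ) < (n + 1).choose m := by exact_mod_cast Nat.choose_pos hm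
  have hch : (n.choose m : ℝ) * (n + 1) = (n + 1).choose m * (n + 1 - m) := by
    have := Nat.choose_mul_succ_eq n m
    zify [hm] at this
    exact_mod_cast this
  have hn : (0 : ℝ) < n + 1 := by positivity
  rw [corruptedLaw, expect_uniformOfFinset, hsum, Finset.card_powersetCard, Finset.card_univ,
    Fintype.card_fin]
  push_cast
  field_simp
  linarith

lemma expect_uniform_isBest (j : Fin N) :
    expect (PMF.uniformOfFintype (Fin N → Fin K)) (fun f => isBest (some (f j))) =
      1 / (K : ℝ) := by
  classical
  have hK : (K : ℝ) ≠ 0 := Nat.cast_ne_zero.2 (NeZero.ne K)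
  have h : PMF.uniformOfFintype (Fin N → Fin K) =
      indep fun _ : Fin N => PMF.uniformOfFintype (Fin K) := by
    ext f
    simp [indep, PMF.ofFintype_apply, ENNReal.inv_pow]
  rw [h, expect_indep_apply (fun _ : Fin N => PMF.uniformOfFintype (Fin K)) j
    (fun k => isBest (some k)), expect_uniformOfFintype]
  simp [isBest]

lemma sum_isBest (x : Profile N K) : ∑ j, isBest (x j) = bestCount x := by
  simp [isBest, bestCount, Finset.sum_boole]

/-- The expected number of recommendations of the best arm. -/
lemma expect_recommended_isBest (m : Fin (N + 1)) (hN : 0 < N) (x : Profile N K) :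
    (expect (corruptedLaw m) fun C => expect (PMF.uniformOfFintype (Fin N → Fin K)) fun f =>
      ∑ j, isBest (recommended x C f j)) = m / K + (1 - m / N) * bestCount x := by
  have hN' : (N : ℝ) ≠ 0 := by positivity
  -- This form is affine in the indicator of `j ∉ C`, so the averages over `f` and over `C` can be
  -- taken one after the other.
  have h : ∀ C f j, isBest (recommended x C f j) = isBest (some (f j)) +
      (if j ∈ C then 0 else 1) * (isBest (x j) - isBest (some (f j))) := by
    intro C f j
    unfold recommended
    split_ifs <;> simp
  simp only [h, expect_sum, expect_add, expect_mul_left, expect_sub, expect_const,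
    expect_uniform_isBest]
  have h2 : ∀ j, expect (corruptedLaw m)
      (fun C => (if j ∈ C then 0 else 1) * (isBest (x j) - 1 / (K : ℝ))) =
      (1 - (m : ℝ) / N) * (isBest (x j) - 1 / (K : ℝ)) := fun j => by
    rw [← expect_corruptedLaw_notMem m j, mul_comm, ← expect_mul_left]
    exact congrArg _ (funext fun C => mul_comm _ _)
  simp only [h2, Finset.sum_add_distrib, ← Finset.mul_sum, Finset.sum_sub_distrib, sum_isBest]
  simp only [Finset.sum_const, Finset.card_univ, Fintype.card_fin, nsmul_eq_mul]
  field_simp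
  ring

/-- The law of the next adoption of an agent that currently adopts an arm. -/
lemma expect_roundLaw_apply (G : SimpleGraph (Fin N)) [DecidableRel G.Adj] (T L : ℕ) (μ : I)
    (p : Fin K → I) (m : Fin (N + 1)) {x : Profile N K} (hx : ∀ i, x i ≠ none) (i : Fin N)
    (F : Adoption K → ℝ) :
    expect (roundLaw G T L μ p m x) (fun y => F (y i)) =
      expect (corruptedLaw m) fun C => expect (PMF.uniformOfFintype (Fin N → Fin K)) fun f =>
        expect (indep fun t : Fin N × Fin T => walk G L t.1) fun dest =>
          expect (suggestion (recommended x C f) dest i) fun v => expect (adopt p (x i) v) F := by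
  rw [roundLaw, ← corruptedLaw]
  simp only [expect_bind, expect_indep_apply, choice_of_ne_none μ (hx _)]

lemma gained_eq_sum (x y : Profile N K) :
    (gained x y : ℝ) = ∑ i ∈ Finset.univ.filter (fun i => x i ≠ some 0), isBest (y i) := by
  simp [gained, isBest, Finset.sum_boole, Finset.filter_filter]

lemma lost_eq_sum (x y : Profile N K) :
    (lost x y : ℝ) = ∑ i ∈ Finset.univ.filter (fun i => x i = some 0), isOther (y i) := by
  simp only [lost, isOther, Finset.sum_boole, Finset.filter_filter]

lemma card_filter_ne_best (x : Profile N K) :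
    ((Finset.univ.filter fun i => x i ≠ some 0).card : ℝ) = N - bestCount x := by
  have h := Finset.card_filter_add_card_filter_not (s := (Finset.univ : Finset (Fin N)))
    (fun i => x i = some 0)
  rw [Finset.card_univ, Fintype.card_fin] at h
  rw [eq_sub_iff_add_eq, bestCount, add_comm]
  exact_mod_cast h

/-- The sampling bounds are linear in the number of recommendations, so averaging over the
corruption leaves only its mean. One `w` serves both bounds and therefore cancels in their
comparison. -/
lemma expect_gained_lost (hN : 2 ≤ N) (G : SimpleGraph (Fin N)) [DecidableRel G.Adj] (T L : ℕ)
    (hL : NearlyUniform G L) (μ : I) (p : Fin K → I) {a : ℝ}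
    (hp : ∀ k, k ≠ 0 → (p k : ℝ) ≤ a) (ha : 0 ≤ a) (m : Fin (N + 1)) {x : Profile N K}
    (hx : ∀ i, x i ≠ none) :
    ∃ w : ℝ, 0 ≤ w ∧
      w * (p 0 * ((N - bestCount x) * (m / K + (1 - m / N) * bestCount x))) ≤
        expect (roundLaw G T L μ p m x) (fun y => (gained x y : ℝ)) ∧
      expect (roundLaw G T L μ p m x) (fun y => (lost x y : ℝ)) ≤
        w * ((1 + 8 / N) *
          (a * (bestCount x * (N - (m / K + (1 - m / N) * bestCount x))))) := by
  obtain ⟨w, hw0, hw⟩ := expect_suggestion_bounds (K := K) hN T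
  have hN0 : 0 < N := by omega
  refine ⟨w, hw0, ?_, ?_⟩
  · simp only [gained_eq_sum, expect_sum]
    have hi : ∀ i ∈ Finset.univ.filter (fun i => x i ≠ some 0),
        w * (p 0 * (m / K + (1 - m / N) * bestCount x)) ≤
          expect (roundLaw G T L μ p m x) (fun y => isBest (y i)) := by
      intro i hi
      rw [expect_roundLaw_apply G T L μ p m hx i isBest, ← expect_recommended_isBest m hN0 x,
        ← mul_assoc, ← expect_mul_left]
      refine expect_mono _ fun C => ?_
      rw [← expect_mul_left]
      refine expect_mono _ fun f => ?_
      simp only [expect_adopt_isBest p (Finset.mem_filter.1 hi).2, expect_mul_left]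
      have h := (hw G L hL (recommended x C f) (recommended_ne_none hx C f) i isBest
        (by simp [isBest]) isBest_nonneg).1
      rw [mul_comm w, mul_assoc]
      exact mul_le_mul_of_nonneg_left h (p 0).2.1
    refine le_trans (le_of_eq ?_) (Finset.card_nsmul_le_sum _ _ _ hi)
    rw [nsmul_eq_mul, card_filter_ne_best]
    ring
  · simp only [lost_eq_sum, expect_sum]
    have hi : ∀ i ∈ Finset.univ.filter (fun i => x i = some 0),
        expect (roundLaw G T L μ p m x) (fun y => isOther (y i)) ≤
          (1 + 8 / N) * w * a * (N - (m / K + (1 - m / N) * bestCount x)) := by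
      intro i hi
      have hS : (N : ℝ) - (m / K + (1 - m / N) * bestCount x) =
          expect (corruptedLaw m) fun C => expect (PMF.uniformOfFintype (Fin N → Fin K)) fun f =>
            ∑ j, isOther (recommended x C f j) := by
        rw [← expect_recommended_isBest m hN0 x]
        simp only [isOther_eq (recommended_ne_none hx _ _ _), Finset.sum_sub_distrib, expect_sub,
          expect_const]
        simp
      rw [expect_roundLaw_apply G T L μ p m hx i isOther, hS, ← expect_mul_left]
      refine expect_mono _ fun C => ?_
      rw [← expect_mul_left]
      refine expect_mono _ fun f => ?_
      have h := (hw G L hL (recommended x C f) (recommended_ne_none hx C f) i isOther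
        (by simp [isOther]) isOther_nonneg).2
      rw [(Finset.mem_filter.1 hi).2]
      calc _ ≤ expect (indep fun t : Fin N × Fin T => walk G L t.1) (fun dest =>
            expect (suggestion (recommended x C f) dest i) fun v => a * isOther v) :=
            expect_mono _ fun dest => expect_mono _ fun v => expect_adopt_isOther_le p hp v
        _ = a * expect (indep fun t : Fin N × Fin T => walk G L t.1) (fun dest =>
            expect (suggestion (recommended x C f) dest i) isOther) := by
            simp only [expect_mul_left]
        _ ≤ a * ((1 + 8 / N) * w * ∑ j, isOther (recommended x C f j)) :=
            mul_le_mul_of_nonneg_left h ha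
        _ = _ := by ring
    refine (Finset.sum_le_card_nsmul _ _ _ hi).trans (le_of_eq ?_)
    rw [nsmul_eq_mul, ← bestCount]
    ring

end RoundBounds

/-- The comparison of gains and losses when the fraction `Q ≤ α` of the agents adopt the best arm
and the fraction `s` is corrupted. -/
lemma loss_rate_le_gain_rate {p₁ p₂ α κ Q s ε : ℝ} (hp₁ : p₁ ≤ 1) (hp₂ : 0 ≤ p₂)
    (hp : p₂ < p₁) (hα0 : 0 < α) (hα1 : α < 1) (hκ0 : 0 < κ) (hκ1 : κ ≤ 1) (hQ0 : 0 ≤ Q)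
    (hQα : Q ≤ α) (hs0 : 0 ≤ s) (hs1 : s ≤ 1)
    (hs : s * ((1 - α) * p₁ + α * p₂) ≤ (1 - α) * (p₁ - p₂)) (hε0 : 0 ≤ ε)
    (hε : ε ≤ κ * (1 - α) * p₁ * ((1 - α) * (p₁ - p₂))) :
    (1 + ε) * (p₂ * (Q * (1 - (s * κ + (1 - s) * Q)))) ≤
      p₁ * ((1 - Q) * (s * κ + (1 - s) * Q)) := by
  have hp₁0 : 0 < p₁ := hp₂.trans_lt hp
  set E := (1 - α) * p₁ + α * p₂ with hE
  set D := (1 - α) * (p₁ - p₂) with hD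
  have hD0 : 0 < D := mul_pos (by linarith) (by linarith)
  set κ' := κ * (1 - α) * p₁ with hκ'
  have hκ'0 : 0 < κ' := mul_pos (mul_pos hκ0 (by linarith)) hp₁0
  have hκ'1 : κ' ≤ 1 :=
    mul_le_one₀ (mul_le_one₀ hκ1 (by linarith) (by linarith)) hp₁0.le hp₁
  have hE1 : E ≤ 1 := by nlinarith
  -- Here `D - s * E ≥ 0` is the hypothesis `hs`, and the term with `α - Q` is nonnegative as `Q ≤
  -- α`.
  have hdiff : p₁ * ((1 - Q) * (s * κ + (1 - s) * Q)) -
      p₂ * (Q * (1 - (s * κ + (1 - s) * Q))) =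
      Q * (D - s * E + (1 - s) * (α - Q) * (p₁ - p₂)) + s * κ * (p₁ * (1 - Q) + p₂ * Q) := by
    rw [hE, hD]
    ring
  have h1 : 0 ≤ (1 - s) * (α - Q) * (p₁ - p₂) :=
    mul_nonneg (mul_nonneg (by linarith) (by linarith)) (by linarith)
  have h2 : Q * (s * κ') ≤ s * κ * (p₁ * (1 - Q) + p₂ * Q) := by
    have h3 : Q * ((1 - α) * p₁) ≤ p₁ * (1 - Q) + p₂ * Q := by
      have h4 : Q * ((1 - α) * p₁) ≤ 1 * ((1 - Q) * p₁) :=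
        mul_le_mul (by linarith) (mul_le_mul_of_nonneg_right (by linarith) hp₁0.le)
          (mul_nonneg (by linarith) hp₁0.le) zero_le_one
      nlinarith [mul_nonneg hp₂ hQ0]
    calc Q * (s * κ') = s * κ * (Q * ((1 - α) * p₁)) := by rw [hκ']; ring
      _ ≤ _ := mul_le_mul_of_nonneg_left h3 (mul_nonneg hs0 hκ0.le)
  -- As `κ' ≤ 1` and `E ≤ 1`, the right side is at least `κ' (D - s E) + s κ' E = κ' D`,
  -- independently of `s`.
  have h5 : ε ≤ D - s * E + s * κ' := by
    have h6 : κ' * (D - s * E) ≤ D - s * E :=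
      mul_le_of_le_one_left (by linarith) hκ'1
    have h7 : s * κ' * E ≤ s * κ' * 1 :=
      mul_le_mul_of_nonneg_left hE1 (mul_nonneg hs0 hκ'0.le)
    nlinarith
  have h8 : Q * ε ≤ Q * (D - s * E + s * κ') := mul_le_mul_of_nonneg_left h5 hQ0
  -- The loss is at most `Q`, so its relative error `ε` costs at most `Q ε`, within the slack `h8`.
  have h9 : p₂ * (Q * (1 - (s * κ + (1 - s) * Q))) ≤ Q := by
    have h10 : 0 ≤ s * κ + (1 - s) * Q :=
      add_nonneg (mul_nonneg hs0 hκ0.le) (mul_nonneg (by linarith) hQ0)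
    have h11 : p₂ * (Q * (1 - (s * κ + (1 - s) * Q))) ≤ p₂ * Q :=
      mul_le_mul_of_nonneg_left (by nlinarith) hp₂
    nlinarith
  have h12 := mul_le_mul_of_nonneg_left h9 hε0
  have h13 := mul_nonneg hQ0 h1
  nlinarith

end CollabBandit

end

theorem theorem3 (K : ℕ) [NeZero K] (hK : 2 ≤ K) (p : Fin K → unitInterval) (hp : Antitone p)
    (hbest : p ⟨1, hK⟩ < p 0) (α : ℝ) (hα0 : 0 < α) (hα1 : α < 1) :
    ∃ N₀ : ℕ, ∀ N : ℕ, N₀ ≤ N →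
      ∀ (G : SimpleGraph (Fin N)) [DecidableRel G.Adj], G.Connected → ¬ G.IsBipartite →
        (∃ L₀ : ℕ, ∀ L : ℕ, L₀ ≤ L → CollabBandit.NearlyUniform G L) ∧
        ∀ (h : ℝ), 0 < h → ∀ (L : ℕ), CollabBandit.NearlyUniform G L →
        ∀ (μ : unitInterval) (τ : ℝ),
          τ ≤ (1 - α) * ((p 0 : ℝ) - p ⟨1, hK⟩) / ((1 - α) * (p 0 : ℝ) + α * p ⟨1, hK⟩) →
        ∀ (c : ℕ → Fin (N + 1)), (∀ r, ((c r : ℕ) : ℝ) ≤ τ * N) →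
        ∀ (Ω : Type*) [MeasurableSpace Ω] (P : MeasureTheory.Measure Ω)
          [MeasureTheory.IsProbabilityMeasure P] (X : ℕ → Ω → CollabBandit.Profile N K),
          CollabBandit.IsRun G (CollabBandit.tokenCount h N) L μ p c P X →
        ∀ (r : ℕ) (x : CollabBandit.Profile N K), P {ω | X r ω = x} ≠ 0 →
          (∀ i, x i ≠ none) → CollabBandit.popularity x ≤ α →
          ∫ ω, (CollabBandit.lost (X r ω) (X (r + 1) ω) : ℝ)
              ∂(ProbabilityTheory.cond P {ω | X r ω = x}) ≤
            ∫ ω, (CollabBandit.gained (X r ω) (X (r + 1) ω) : ℝ)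
              ∂(ProbabilityTheory.cond P {ω | X r ω = x}) := by
  have hp₂ : (0 : ℝ) ≤ p ⟨1, hK⟩ := (p ⟨1, hK⟩).2.1
  have hp₁ : (p 0 : ℝ) ≤ 1 := (p 0).2.2
  have hlt : ((p ⟨1, hK⟩ : unitInterval) : ℝ) < p 0 := hbest
  have hle : ∀ k, k ≠ 0 → (p k : ℝ) ≤ p ⟨1, hK⟩ := fun k hk =>
    hp (Fin.mk_le_of_le_val (Nat.one_le_iff_ne_zero.2 fun h => hk (Fin.ext h)))
  have hK0 : (0 : ℝ) < K := by positivity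
  have hK1 : 1 / (K : ℝ) ≤ 1 := by
    rw [div_le_one hK0]
    exact_mod_cast (by omega : 1 ≤ K)
  -- The error that `loss_rate_le_gain_rate` tolerates for `κ = 1/K`; `N ≥ 8/ε₀` makes `8/N` fit.
  set ε₀ : ℝ := 1 / K * (1 - α) * p 0 * ((1 - α) * (p 0 - p ⟨1, hK⟩)) with hε₀
  have hε₀0 : 0 < ε₀ :=
    mul_pos (mul_pos (mul_pos (by positivity) (by linarith)) (hp₂.trans_lt hlt))
      (mul_pos (by linarith) (by linarith))
  obtain ⟨n, hn⟩ := exists_nat_ge (8 / ε₀)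
  refine ⟨max 2 n, fun N hN G _ hconn hbip =>
    ⟨CollabBandit.exists_forall_nearlyUniform hconn hbip, ?_⟩⟩
  intro h _ L hL μ τ hτ c hc Ω _ P _ X hX r x hx hx' hpop
  have hN2 : 2 ≤ N := (le_max_left _ _).trans hN
  have hN0 : (0 : ℝ) < N := by
    have : (2 : ℝ) ≤ N := by exact_mod_cast hN2
    linarith
  rw [hX.integral_cond r x hx fun x y => (CollabBandit.lost x y : ℝ),
    hX.integral_cond r x hx fun x y => (CollabBandit.gained x y : ℝ)]
  obtain ⟨w, hw0, hgain, hloss⟩ := CollabBandit.expect_gained_lost hN2 G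
    (CollabBandit.tokenCount h N) L hL μ p hle hp₂ (c (r + 1)) hx'
  refine hloss.trans (le_trans (mul_le_mul_of_nonneg_left ?_ hw0) hgain)
  set m : ℝ := ((c (r + 1) : ℕ) : ℝ)
  have hm : m ≤ N := Nat.cast_le.2 (Nat.lt_succ_iff.1 (c (r + 1)).2)
  have hε : 8 / (N : ℝ) ≤ ε₀ := by
    have h1 : (n : ℝ) ≤ N := by exact_mod_cast (le_max_right _ _).trans hN
    rw [div_le_iff₀ hN0, mul_comm, ← div_le_iff₀ hε₀0]
    exact hn.trans h1
  have hs : m / N * ((1 - α) * p 0 + α * p ⟨1, hK⟩) ≤ (1 - α) * (p 0 - p ⟨1, hK⟩) := by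
    have hE : 0 < (1 - α) * (p 0 : ℝ) + α * p ⟨1, hK⟩ :=
      add_pos_of_pos_of_nonneg (mul_pos (by linarith) (hp₂.trans_lt hlt))
        (mul_nonneg hα0.le hp₂)
    rw [← le_div_iff₀ hE]
    exact ((div_le_iff₀ hN0).2 (hc (r + 1))).trans hτ
  have key := CollabBandit.loss_rate_le_gain_rate (Q := CollabBandit.popularity x) (s := m / N)
    (κ := 1 / K) hp₁ hp₂ hlt hα0 hα1 (by positivity) hK1
    (div_nonneg (Nat.cast_nonneg _) hN0.le) hpop (by positivity) ((div_le_one hN0).2 hm) hs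
    (by positivity) hε
  -- The factor `N²` turns fractions of agents back into counts.
  have hmul := mul_le_mul_of_nonneg_left key (sq_nonneg (N : ℝ))
  rw [CollabBandit.popularity] at hmul
  convert hmul using 1 <;> field_simp
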